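/- Let $\Gamma$ be a cardinal number with $\Gamma^{\omega}=\Gamma$ (cardinal exponentiation, $\omega=\aleph_0$), and let $X$ be a real Banach space of density $\Gamma$, i.e. the least cardinality of a dense subset of $X$ is $\Gamma$. Suppose that $X$ contains an isomorphic copy of $\ell_1(\Gamma)$, i.e. some linear subspace of $X$ is linearly homeomorphic to $\ell_1(\Gamma)$. Then there is an equivalent norm $|||\cdot|||$ on $X$ such that both of the following hold: 1. $(X,|||\cdot|||)$ admits a disjoint tiling by balls of radius $1$; 2. $(X,|||\cdot|||)$ admits a lattice tiling by balls. Here a body is a set that is the closure of its non-empty interior, and a tiling of a normed space is a family of bodies that covers the space and whose distinct members have disjoint interiors. A tiling as in 1. is a tiling all of whose members are closed balls of radius $1$ with respect to $|||\cdot|||$ and whose distinct members are disjoint. A tiling as in 2. is a tiling of the form $\{d+B : d\in D\}$, where $B=\{x\in X: |||x|||\le 1\}$ and $D$ is a discrete subgroup of $X$. -/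

import Mathlib

open scoped Cardinal

universe u

namespace BallTiling

/-- The density (character) of a topological space: the least cardinality of a dense subset. -/
noncomputable def density (X : Type u) [TopologicalSpace X] : Cardinal.{u} :=
  sInf {κ : Cardinal.{u} | ∃ s : Set X, Dense s ∧ #s = κ}

/-- The real Banach space `ℓ₁(Γ)` of absolutely summable families indexed by a set of
cardinality `Γ`. -/
abbrev EllOne (Γ : Cardinal.{u}) : Type u :=
  lp (fun _ : Γ.out => ℝ) 1

/-- `X` contains an isomorphic copy of `ℓ₁(Γ)`: some linear subspace of `X`, with the norm
inherited from `X`, is linearly homeomorphic to `ℓ₁(Γ)`. -/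
def ContainsEllOne (Γ : Cardinal.{u}) (X : Type u) [NormedAddCommGroup X] [NormedSpace ℝ X] :
    Prop :=
  ∃ Y : Submodule ℝ X, Nonempty (EllOne Γ ≃L[ℝ] Y)

/-- `p` is an equivalent norm on `X`. The lower estimate makes the seminorm `p` a norm, and the two
estimates together say that `p` induces the topology of `X`; so interiors, closures and
discreteness with respect to `p` are those of `X`. -/
def IsEquivalentNorm {X : Type u} [NormedAddCommGroup X] [NormedSpace ℝ X]
    (p : Seminorm ℝ X) : Prop :=
  ∃ c C : ℝ, 0 < c ∧ 0 < C ∧ ∀ x : X, c * ‖x‖ ≤ p x ∧ p x ≤ C * ‖x‖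

/-- A body: a set that is the closure of its non-empty interior. -/
def IsBody {X : Type u} [TopologicalSpace X] (B : Set X) : Prop :=
  (interior B).Nonempty ∧ closure (interior B) = B

/-- A tiling: a family of bodies that covers the space and has mutually disjoint interiors. -/
structure IsTiling {X : Type u} [TopologicalSpace X] (𝒯 : Set (Set X)) : Prop where
  isBody : ∀ T ∈ 𝒯, IsBody T
  covers : ⋃₀ 𝒯 = Set.univ
  nonoverlapping : 𝒯.Pairwise fun S T => Disjoint (interior S) (interior T)

/-- `𝒯` is a disjoint tiling by `p`-balls of radius one: every tile is a closed unit ball (with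
arbitrary centre) and distinct tiles are disjoint. -/
def IsDisjointTilingByUnitBalls {X : Type u} [NormedAddCommGroup X] [NormedSpace ℝ X]
    (p : Seminorm ℝ X) (𝒯 : Set (Set X)) : Prop :=
  IsTiling 𝒯 ∧ (∀ T ∈ 𝒯, ∃ x : X, T = p.closedBall x 1) ∧ 𝒯.Pairwise Disjoint

/-- `𝒯` is a lattice tiling by `p`-balls: its tiles are the translates `d + B` of the closed
`p`-unit ball `B = {x | p x ≤ 1}` by the elements `d` of a discrete subgroup. -/
def IsLatticeTilingByBalls {X : Type u} [NormedAddCommGroup X] [NormedSpace ℝ X]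
    (p : Seminorm ℝ X) (𝒯 : Set (Set X)) : Prop :=
  IsTiling 𝒯 ∧ ∃ D : AddSubgroup X, DiscreteTopology D ∧
    𝒯 = {T | ∃ d ∈ D, T = (fun x => d + x) '' p.closedBall 0 1}

end BallTiling

/-! The heart is an equivalent norm `p` and unit vectors `e i`, indexed by a set of cardinality Γ,
such that every `x` satisfies `p (x + t • e i) ≥ p x + |t|` for all but countably many `i`.

To build it, extend the sign functionals on the copy `Y` of ℓ₁(Γ) to functionals `g A` on `X` by
Hahn–Banach, with a common norm bound. For fixed `x`, `A ↦ g A x` is a bounded function on the sign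
cube; Bessel's inequality leaves it only countably many nonzero Walsh coefficients `c B x`, so all
but countably many coordinates `i` occur in no active frequency. Integrating against Riesz products,
which are nonnegative of mean one, gives functionals with the same bound that still realize every
finite sign pattern on the `e i`, and whose value at `x` ignores the sign at any inactive `i`. Their
supremum `q` is therefore additive between `x` and `e i`: the sign at `i` can be chosen freely.
Adding the distance to `Y` turns `q` into an equivalent norm.

Since Γ^ω = Γ, the space has at most Γ points, so it can be well-ordered with initial segments
smaller than Γ. As Γ is uncountable, fewer than Γ vectors always share one good `e`. In a
transfinite recursion, a point `x` at distance more than one from all earlier centres receives the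
centre `x + e`: it covers `x`, and its distance to each earlier centre exceeds 1 + 1. For the
lattice the same choice is made with the subgroup generated so far. -/

namespace BallTiling

open Filter Topology

/-! ### Walsh functions and Riesz products on the finite sign cube -/

section Walsh

variable {ι : Type*}

/-- The average of `φ` over the subsets of `F`. -/
noncomputable def avg (F : Finset ι) (φ : Finset ι → ℝ) : ℝ :=
  (2 ^ F.card)⁻¹ * ∑ A ∈ F.powerset, φ A

theorem avg_le_avg (F : Finset ι) {φ ψ : Finset ι → ℝ} (h : ∀ A, φ A ≤ ψ A) :
    avg F φ ≤ avg F ψ := by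
  unfold avg
  gcongr with A
  exact h A

theorem avg_const (F : Finset ι) (a : ℝ) : avg F (fun _ => a) = a := by
  simp [avg]

theorem abs_avg_le (F : Finset ι) (φ : Finset ι → ℝ) : |avg F φ| ≤ avg F fun A => |φ A| := by
  unfold avg
  rw [abs_mul, abs_of_pos (by positivity : (0 : ℝ) < (2 ^ F.card)⁻¹)]
  gcongr
  exact Finset.abs_sum_le_sum_abs _ _

theorem avg_add (F : Finset ι) (φ ψ : Finset ι → ℝ) :
    avg F (fun A => φ A + ψ A) = avg F φ + avg F ψ := by
  simp only [avg, Finset.sum_add_distrib, mul_add]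

theorem avg_const_mul (F : Finset ι) (a : ℝ) (φ : Finset ι → ℝ) :
    avg F (fun A => a * φ A) = a * avg F φ := by
  simp only [avg, ← Finset.mul_sum]; ring

theorem avg_sum {κ : Type*} (F : Finset ι) (s : Finset κ) (φ : κ → Finset ι → ℝ) :
    avg F (fun A => ∑ k ∈ s, φ k A) = ∑ k ∈ s, avg F (φ k) := by
  simp only [avg, Finset.mul_sum]
  rw [Finset.sum_comm]

variable [DecidableEq ι]

/-- The sign function on `ι` that is `-1` exactly on `A`. -/
def sgn (A : Finset ι) (i : ι) : ℝ := if i ∈ A then -1 else 1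

/-- The Walsh function with frequency `B`, evaluated at the sign function of `A`. -/
def walsh (B A : Finset ι) : ℝ := ∏ i ∈ B, sgn A i

theorem sgn_mul_self (A : Finset ι) (i : ι) : sgn A i * sgn A i = 1 := by
  unfold sgn; split_ifs <;> norm_num

theorem abs_sgn (A : Finset ι) (i : ι) : |sgn A i| = 1 := by
  unfold sgn; split_ifs <;> norm_num

theorem abs_walsh (B A : Finset ι) : |walsh B A| = 1 := by
  simp [walsh, Finset.abs_prod, abs_sgn]

/-- Both sides are (-1) to the power |A ∩ B|. -/
theorem walsh_comm (B A : Finset ι) : walsh B A = walsh A B := by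
  unfold walsh sgn
  rw [Finset.prod_ite_mem, Finset.prod_ite_mem, Finset.inter_comm]

theorem walsh_empty_left (A : Finset ι) : walsh ∅ A = 1 := by simp [walsh]

/-- By symmetry of `walsh` the sum factors over the coordinates of `F`; a coordinate where `B` and
`C` differ contributes the factor 1 - 1. -/
theorem sum_walsh_mul_walsh {F B C : Finset ι} (hB : B ⊆ F) (hC : C ⊆ F) :
    ∑ A ∈ F.powerset, walsh B A * walsh C A = if B = C then (2 : ℝ) ^ F.card else 0 := by
  have h : ∑ A ∈ F.powerset, walsh B A * walsh C A = ∏ i ∈ F, (1 + sgn B i * sgn C i) := by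
    rw [Finset.prod_one_add]
    refine Finset.sum_congr rfl fun A _ => ?_
    rw [walsh_comm B, walsh_comm C, walsh, walsh, Finset.prod_mul_distrib]
  rw [h]
  split_ifs with hBC
  · subst hBC
    simp [sgn_mul_self, one_add_one_eq_two]
  · obtain ⟨i, hi⟩ : ∃ i, ¬ (i ∈ B ↔ i ∈ C) := by
      by_contra! hcon
      exact hBC (Finset.ext hcon)
    have hiF : i ∈ F := by
      by_contra hn
      exact hi ⟨fun h => absurd (hB h) hn, fun h => absurd (hC h) hn⟩
    refine Finset.prod_eq_zero hiF ?_
    unfold sgn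
    split_ifs with h1 h2 h2 <;> first | (exfalso; tauto) | norm_num

theorem avg_walsh_mul_walsh {F B C : Finset ι} (hB : B ⊆ F) (hC : C ⊆ F) :
    avg F (fun A => walsh B A * walsh C A) = if B = C then 1 else 0 := by
  rw [avg, sum_walsh_mul_walsh hB hC]
  split_ifs <;> simp

/-- Bessel's inequality for the Walsh functions. -/
theorem sum_sq_avg_mul_walsh_le (F : Finset ι) (s : Finset (Finset ι)) (hs : ∀ B ∈ s, B ⊆ F)
    (φ : Finset ι → ℝ) :
    ∑ B ∈ s, avg F (fun A => φ A * walsh B A) ^ 2 ≤ avg F fun A => φ A ^ 2 := by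
  set a : Finset ι → ℝ := fun B => avg F (fun A => φ A * walsh B A) with ha
  set ψ : Finset ι → ℝ := fun A => ∑ B ∈ s, a B * walsh B A with hψ
  have h1 : avg F (fun A => φ A * ψ A) = ∑ B ∈ s, a B ^ 2 := by
    have : (fun A => φ A * ψ A) = fun A => ∑ B ∈ s, a B * (φ A * walsh B A) := by
      funext A
      rw [hψ, Finset.mul_sum]
      exact Finset.sum_congr rfl fun B _ => by ring
    rw [this, avg_sum]
    refine Finset.sum_congr rfl fun B _ => ?_
    rw [avg_const_mul, sq]
  have h2 : avg F (fun A => ψ A * ψ A) = ∑ B ∈ s, a B ^ 2 := by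
    have : (fun A => ψ A * ψ A) =
        fun A => ∑ B ∈ s, ∑ C ∈ s, (a B * a C) * (walsh B A * walsh C A) := by
      funext A
      rw [hψ, Finset.sum_mul_sum]
      exact Finset.sum_congr rfl fun B _ => Finset.sum_congr rfl fun C _ => by ring
    rw [this, avg_sum]
    refine Finset.sum_congr rfl fun B hB => ?_
    rw [avg_sum]
    have : ∀ C ∈ s, avg F (fun A => (a B * a C) * (walsh B A * walsh C A)) =
        if B = C then a B * a C else 0 := by
      intro C hC
      rw [avg_const_mul, avg_walsh_mul_walsh (hs B hB) (hs C hC)]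
      split_ifs <;> simp
    rw [Finset.sum_congr rfl this, Finset.sum_ite_eq, if_pos hB, sq]
  -- Pointwise φψ ≤ (φ² + ψ²)/2; since `ψ` is the projection of `φ`, both ⟨φ, ψ⟩ and ⟨ψ, ψ⟩ equal
  -- the coefficient sum.
  have h3 : avg F (fun A => φ A * ψ A) ≤
      2⁻¹ * avg F (fun A => φ A ^ 2) + 2⁻¹ * avg F (fun A => ψ A * ψ A) := by
    rw [← avg_const_mul, ← avg_const_mul, ← avg_add]
    exact avg_le_avg F fun A => by nlinarith [sq_nonneg (φ A - ψ A)]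
  rw [h1, h2] at h3
  linarith

/-- The Riesz product with frequencies in `F` and signs given by `T`. -/
def riesz (F T A : Finset ι) : ℝ := ∏ i ∈ F, (1 + sgn T i * sgn A i)

theorem riesz_eq_sum (F T A : Finset ι) :
    riesz F T A = ∑ B ∈ F.powerset, walsh B T * walsh B A := by
  rw [riesz, Finset.prod_one_add]
  exact Finset.sum_congr rfl fun B _ => by rw [walsh, walsh, Finset.prod_mul_distrib]

theorem riesz_nonneg (F T A : Finset ι) : 0 ≤ riesz F T A := by
  refine Finset.prod_nonneg fun i _ => ?_
  unfold sgn
  split_ifs <;> norm_num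

/-- Only the empty frequency of the expansion survives averaging. -/
theorem avg_riesz {F G : Finset ι} (hFG : F ⊆ G) (T : Finset ι) : avg G (riesz F T) = 1 := by
  have h : riesz F T = fun A => ∑ B ∈ F.powerset, walsh B T * (walsh B A * walsh ∅ A) := by
    funext A
    simp only [riesz_eq_sum, walsh_empty_left, mul_one]
  rw [h, avg_sum]
  have h' : ∀ B ∈ F.powerset, avg G (fun A => walsh B T * (walsh B A * walsh ∅ A)) =
      if B = ∅ then walsh B T else 0 := by
    intro B hB
    rw [avg_const_mul, avg_walsh_mul_walsh ((Finset.mem_powerset.1 hB).trans hFG)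
      (Finset.empty_subset _)]
    split_ifs <;> simp
  rw [Finset.sum_congr rfl h', Finset.sum_ite_eq']
  simp [walsh_empty_left]

/-- The Riesz product vanishes unless `A` and `T` agree on `F`. -/
theorem sgn_mul_riesz {F : Finset ι} {i : ι} (hi : i ∈ F) (T A : Finset ι) :
    sgn A i * riesz F T A = sgn T i * riesz F T A := by
  rw [riesz, ← Finset.mul_prod_erase F _ hi, ← mul_assoc, ← mul_assoc]
  congr 1
  linear_combination sgn T i * sgn_mul_self A i - sgn A i * sgn_mul_self T i

end Walsh

/-! ### Averaged functionals and the ℓ₁-additive seminorm -/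

section Functionals

variable {ι : Type*} [DecidableEq ι] {X : Type*} [NormedAddCommGroup X] [NormedSpace ℝ X]

/-- Walsh coefficients of a bounded family of functionals, as limits of averages. -/
theorem exists_walsh_coefficients (g : Finset ι → X →ₗ[ℝ] ℝ) (M : ℝ)
    (hg : ∀ A x, |g A x| ≤ M * ‖x‖) (U : Ultrafilter (Finset ι)) :
    ∃ c : Finset ι → X →ₗ[ℝ] ℝ, ∀ B x,
      Tendsto (fun F => avg F fun A => g A x * walsh B A) U (𝓝 (c B x)) := by
  have key : ∀ B x, ∃ l, Tendsto (fun F => avg F fun A => g A x * walsh B A) U (𝓝 l) := by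
    intro B x
    have hb : ∀ F, avg F (fun A => g A x * walsh B A) ∈ Set.Icc (-(M * ‖x‖)) (M * ‖x‖) := by
      intro F
      rw [Set.mem_Icc, ← abs_le]
      refine (abs_avg_le F _).trans ?_
      rw [← avg_const F (M * ‖x‖)]
      refine avg_le_avg F fun A => ?_
      rw [abs_mul, abs_walsh, mul_one]
      exact hg A x
    obtain ⟨l, -, hl⟩ := isCompact_Icc.ultrafilter_le_nhds
      (U.map fun F => avg F fun A => g A x * walsh B A)
      (le_principal_iff.2 (Filter.mem_map.2 (Filter.univ_mem' hb)))
    exact ⟨l, hl⟩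
  choose l hl using key
  have hadd : ∀ B x y, l B (x + y) = l B x + l B y := fun B x y => by
    refine tendsto_nhds_unique (hl B (x + y)) (((hl B x).add (hl B y)).congr fun F => ?_)
    rw [← avg_add]
    congr 1
    funext A
    rw [map_add, add_mul]
  have hsmul : ∀ B (r : ℝ) x, l B (r • x) = r • l B x := fun B r x => by
    refine tendsto_nhds_unique (hl B (r • x)) (((hl B x).const_smul r).congr fun F => ?_)
    rw [smul_eq_mul, ← avg_const_mul]
    congr 1
    funext A
    rw [map_smul, smul_eq_mul, mul_assoc]
  exact ⟨fun B => { toFun := l B, map_add' := hadd B, map_smul' := hsmul B }, hl⟩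

/-- The functional with Walsh coefficients `c` integrated against a Riesz product. -/
def rieszFunctional (c : Finset ι → X →ₗ[ℝ] ℝ) (F T : Finset ι) : X →ₗ[ℝ] ℝ :=
  ∑ B ∈ F.powerset, walsh B T • c B

theorem rieszFunctional_apply (c : Finset ι → X →ₗ[ℝ] ℝ) (F T : Finset ι) (x : X) :
    rieszFunctional c F T x = ∑ B ∈ F.powerset, walsh B T * c B x := by
  simp [rieszFunctional]

variable {g c : Finset ι → X →ₗ[ℝ] ℝ} {l : Filter (Finset ι)}

theorem tendsto_rieszFunctional
    (hc : ∀ B x, Tendsto (fun F => avg F fun A => g A x * walsh B A) l (𝓝 (c B x)))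
    (F T : Finset ι) (x : X) :
    Tendsto (fun G => avg G fun A => g A x * riesz F T A) l (𝓝 (rieszFunctional c F T x)) := by
  rw [rieszFunctional_apply]
  refine (tendsto_finsetSum _ fun B _ => (hc B x).const_mul (walsh B T)).congr fun G => ?_
  simp_rw [← avg_const_mul]
  rw [← avg_sum]
  congr 1
  funext A
  rw [riesz_eq_sum, Finset.mul_sum]
  exact Finset.sum_congr rfl fun B _ => by ring

/-- The weights `riesz F T` are nonnegative with mean one, so the value is a limit of weighted means
of `g A x`. -/
theorem abs_rieszFunctional_le [l.NeBot] (hl : l ≤ atTop)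
    (hc : ∀ B x, Tendsto (fun F => avg F fun A => g A x * walsh B A) l (𝓝 (c B x)))
    (F T : Finset ι) {x : X} {a : ℝ} (ha : ∀ A, |g A x| ≤ a) :
    |rieszFunctional c F T x| ≤ a := by
  refine le_of_tendsto (tendsto_rieszFunctional hc F T x).abs ?_
  filter_upwards [hl (eventually_ge_atTop F)] with G hG
  calc |avg G fun A => g A x * riesz F T A| ≤ avg G fun A => |g A x * riesz F T A| :=
        abs_avg_le G _
    _ ≤ avg G fun A => a * riesz F T A := by
        refine avg_le_avg G fun A => ?_
        rw [abs_mul, abs_of_nonneg (riesz_nonneg F T A)]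
        exact mul_le_mul_of_nonneg_right (ha A) (riesz_nonneg F T A)
    _ = a := by rw [avg_const_mul, avg_riesz hG, mul_one]

theorem rieszFunctional_eq_sgn [l.NeBot] (hl : l ≤ atTop)
    (hc : ∀ B x, Tendsto (fun F => avg F fun A => g A x * walsh B A) l (𝓝 (c B x)))
    {F : Finset ι} (T : Finset ι) {i : ι} (hi : i ∈ F) {x : X} (hx : ∀ A, g A x = sgn A i) :
    rieszFunctional c F T x = sgn T i := by
  refine tendsto_nhds_unique (tendsto_rieszFunctional hc F T x)
    (tendsto_const_nhds.congr' ?_)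
  filter_upwards [hl (eventually_ge_atTop F)] with G hG
  simp_rw [hx, sgn_mul_riesz hi]
  rw [avg_const_mul, avg_riesz hG, mul_one]

/-- Bessel's inequality passes to the limit, so the squared coefficients are summable. -/
theorem countable_support_walsh_coefficients [l.NeBot] (hl : l ≤ atTop)
    (hc : ∀ B x, Tendsto (fun F => avg F fun A => g A x * walsh B A) l (𝓝 (c B x)))
    {x : X} {a : ℝ} (ha : ∀ A, |g A x| ≤ a) : {B | c B x ≠ 0}.Countable := by
  have hsum : Summable fun B => c B x ^ 2 := by
    refine summable_of_sum_le (c := a ^ 2) (fun B => sq_nonneg _) fun s => ?_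
    refine le_of_tendsto (tendsto_finsetSum _ fun B _ => (hc B x).pow 2) ?_
    filter_upwards [hl (eventually_ge_atTop (s.sup id))] with F hF
    refine (sum_sq_avg_mul_walsh_le F s (fun B hB => ?_) _).trans ?_
    · exact (Finset.le_sup (f := id) hB).trans hF
    · rw [← avg_const F (a ^ 2)]
      exact avg_le_avg F fun A => sq_le_sq' (abs_le.1 (ha A)).1 (abs_le.1 (ha A)).2
  refine hsum.countable_support.mono fun B hB => ?_
  simpa using hB

theorem rieszFunctional_erase {x : X} {i : ι} (hx : ∀ B, i ∈ B → c B x = 0) (F T : Finset ι) :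
    rieszFunctional c F T x = rieszFunctional c (F.erase i) T x := by
  rw [rieszFunctional_apply, rieszFunctional_apply]
  refine (Finset.sum_subset (Finset.powerset_mono.2 (Finset.erase_subset i F))
    fun B hB hB' => ?_).symm
  have : i ∈ B := by
    by_contra hi
    exact hB' (Finset.mem_powerset.2 (Finset.subset_erase.2 ⟨Finset.mem_powerset.1 hB, hi⟩))
  rw [hx B this, mul_zero]

theorem rieszFunctional_congr {F T T' : Finset ι} (h : ∀ i ∈ F, sgn T i = sgn T' i) :
    rieszFunctional c F T = rieszFunctional c F T' := by
  refine Finset.sum_congr rfl fun B hB => ?_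
  rw [walsh, walsh, Finset.prod_congr rfl fun i hi => h i (Finset.mem_powerset.1 hB hi)]

/-- From a bounded family of functionals realizing all finite sign changes on `e`, a seminorm for
which `e` behaves like the unit vector basis of `ℓ₁`, and which is `ℓ₁`-additive between any vector
and all but countably many members of `e`. -/
theorem exists_seminorm_of_signs (g : Finset ι → X →ₗ[ℝ] ℝ) (e : ι → X) (M : ℝ)
    (hg : ∀ A x, |g A x| ≤ M * ‖x‖) (he : ∀ A i, g A (e i) = sgn A i) :
    ∃ q : Seminorm ℝ X, (∀ x, q x ≤ M * ‖x‖) ∧ (∀ i, q (e i) ≤ 1) ∧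
      (∀ (F : Finset ι) (a : ι → ℝ), ∑ i ∈ F, |a i| ≤ q (∑ i ∈ F, a i • e i)) ∧
      ∀ x, ∃ S : Set ι, S.Countable ∧ ∀ i ∉ S, ∀ t : ℝ, q x + |t| ≤ q (x + t • e i) := by
  -- An ultrafilter makes all the bounded averages converge; refining `atTop` ensures that any given
  -- finite set of coordinates is eventually contained in `F`.
  set U : Ultrafilter (Finset ι) := Ultrafilter.of atTop
  have hU : (U : Filter (Finset ι)) ≤ atTop := Ultrafilter.of_le atTop
  obtain ⟨c, hc⟩ := exists_walsh_coefficients g M hg U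
  have hf : ∀ k : Finset ι × Finset ι, ∀ x a, (∀ A, |g A x| ≤ a) →
      |rieszFunctional c k.1 k.2 x| ≤ a :=
    fun k x a ha => abs_rieszFunctional_le hU hc k.1 k.2 ha
  set f : Finset ι × Finset ι → Seminorm ℝ X :=
    fun k => (normSeminorm ℝ ℝ).comp (rieszFunctional c k.1 k.2) with hfdef
  have hfk : ∀ (k : Finset ι × Finset ι) (x : X), f k x = |rieszFunctional c k.1 k.2 x| := fun k x => rfl
  have hbdd : BddAbove (Set.range f) := by
    rw [Seminorm.bddAbove_range_iff]
    intro x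
    refine ⟨M * ‖x‖, ?_⟩
    rintro _ ⟨k, rfl⟩
    exact hf k x _ fun A => hg A x
  have hq : ∀ x, (⨆ k, f k) x = ⨆ k, f k x := fun x => Seminorm.iSup_apply hbdd
  have hle : ∀ (k : Finset ι × Finset ι) (x : X), |rieszFunctional c k.1 k.2 x| ≤ (⨆ k, f k) x := by
    intro k x
    rw [hq]
    exact le_ciSup (Seminorm.bddAbove_range_iff.1 hbdd x) k
  refine ⟨⨆ k, f k, fun x => ?_, fun i => ?_, fun F a => ?_, fun x => ?_⟩
  · rw [hq]
    exact ciSup_le fun k => hf k x _ fun A => hg A x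
  · rw [hq]
    exact ciSup_le fun k => hf k _ _ fun A => by rw [he, abs_sgn]
  -- The sign pattern of the coefficients `a` norms the sum.
  · set T := F.filter fun i => a i < 0 with hT
    refine le_trans (le_of_eq ?_) (hle (F, T) _)
    have : rieszFunctional c F T (∑ i ∈ F, a i • e i) = ∑ i ∈ F, |a i| := by
      rw [map_sum]
      refine Finset.sum_congr rfl fun i hi => ?_
      rw [map_smul, rieszFunctional_eq_sgn hU hc T hi fun A => he A i, smul_eq_mul, sgn]
      by_cases h : a i < 0
      · rw [if_pos (Finset.mem_filter.2 ⟨hi, h⟩), abs_of_neg h]; ring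
      · rw [if_neg fun h' : i ∈ T => h (Finset.mem_filter.1 h').2, abs_of_nonneg (not_lt.1 h)]; ring
    rw [this, abs_of_nonneg (Finset.sum_nonneg fun i _ => abs_nonneg _)]
  · refine ⟨⋃ B ∈ {B | c B x ≠ 0}, (B : Set ι), ?_, fun i hi t => ?_⟩
    · exact (countable_support_walsh_coefficients hU hc fun A => hg A x).biUnion
        fun B _ => B.countable_toSet
    have hi' : ∀ B, i ∈ B → c B x = 0 := by
      intro B hB
      by_contra hne
      exact hi (Set.mem_biUnion (show B ∈ {B | c B x ≠ 0} from hne) hB)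
    rw [← le_sub_iff_add_le, hq]
    refine ciSup_le fun k => ?_
    rw [le_sub_iff_add_le, hfk]
    obtain ⟨F, T⟩ := k
    -- Changing `T` at `i`, or adding `i` to `F`, leaves the value at `x` unchanged, so both signs
    -- of `t` are available.
    have key : ∀ T', (∀ j, j ≠ i → sgn T' j = sgn T j) →
        |rieszFunctional c F T x + t * sgn T' i| ≤ (⨆ k, f k) (x + t • e i) := by
      intro T' hT'
      refine le_trans (le_of_eq ?_) (hle (insert i F, T') _)
      rw [map_add, map_smul, rieszFunctional_eq_sgn hU hc T' (Finset.mem_insert_self i F)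
        fun A => he A i, rieszFunctional_erase hi' F, rieszFunctional_erase hi' (insert i F),
        Finset.erase_insert_eq_erase, smul_eq_mul,
        rieszFunctional_congr fun j hj => hT' j (Finset.ne_of_mem_erase hj)]
    have h1 := key (insert i T) fun j hj => by simp [sgn, hj]
    have h2 := key (T.erase i) fun j hj => by simp [sgn, hj]
    have s1 : sgn (insert i T) i = -1 := by simp [sgn]
    have s2 : sgn (T.erase i) i = 1 := by simp [sgn]
    rw [s1] at h1
    rw [s2] at h2
    obtain ⟨h1a, h1b⟩ := abs_le.1 h1
    obtain ⟨h2a, h2b⟩ := abs_le.1 h2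
    rcases abs_cases (rieszFunctional c F T x) with ⟨h, -⟩ | ⟨h, -⟩ <;>
    rcases abs_cases t with ⟨h', -⟩ | ⟨h', -⟩ <;> rw [h, h'] <;> linarith

end Functionals

/-! ### From the seminorm to an equivalent norm -/

section Renorming

theorem continuous_of_le_mul_norm {X : Type*} [NormedAddCommGroup X] [NormedSpace ℝ X]
    {p : Seminorm ℝ X} {C : ℝ} (h : ∀ x, p x ≤ C * ‖x‖) : Continuous p := by
  refine Seminorm.continuous_of_continuousAt_zero ?_
  rw [ContinuousAt, map_zero]
  refine squeeze_zero (fun x => apply_nonneg p x) h ?_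
  have : Tendsto (fun x : X => C * ‖x‖) (𝓝 0) (𝓝 (C * ‖(0 : X)‖)) :=
    (continuous_const.mul continuous_norm).tendsto 0
  simpa using this

variable {ι : Type*}

theorem summable_abs_lp_one (u : lp (fun _ : ι => ℝ) 1) : Summable fun i => |u i| := by
  have := lp.hasSum_norm (p := 1) (by simp) u
  simpa using this.summable

theorem hasSum_abs_lp_one (u : lp (fun _ : ι => ℝ) 1) : HasSum (fun i => |u i|) ‖u‖ := by
  have := lp.hasSum_norm (p := 1) (by simp) u
  simpa using this

variable [DecidableEq ι]

theorem summable_sgn_mul_lp_one (A : Finset ι) (u : lp (fun _ : ι => ℝ) 1) :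
    Summable fun i => sgn A i * u i :=
  Summable.of_norm (by simpa [abs_mul, abs_sgn] using summable_abs_lp_one u)

/-- The functional on `ℓ₁` given by the sign function of `A`. -/
noncomputable def signFunctional (A : Finset ι) : lp (fun _ : ι => ℝ) 1 →L[ℝ] ℝ :=
  LinearMap.mkContinuous
    { toFun := fun u => ∑' i, sgn A i * u i
      map_add' := fun u v => by
        rw [← (summable_sgn_mul_lp_one A u).tsum_add (summable_sgn_mul_lp_one A v)]
        exact tsum_congr fun i => by rw [lp.coeFn_add, Pi.add_apply, mul_add]
      map_smul' := fun r u => by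
        rw [RingHom.id_apply, smul_eq_mul, ← tsum_mul_left]
        exact tsum_congr fun i => by
          rw [lp.coeFn_smul, Pi.smul_apply, smul_eq_mul, mul_left_comm] }
    1 (by
      intro u
      rw [one_mul, ← (hasSum_abs_lp_one u).tsum_eq]
      refine (norm_tsum_le_tsum_norm (summable_sgn_mul_lp_one A u).norm).trans (le_of_eq ?_)
      exact tsum_congr fun i => by rw [Real.norm_eq_abs, abs_mul, abs_sgn, one_mul])

theorem norm_signFunctional_le (A : Finset ι) : ‖signFunctional A‖ ≤ 1 :=
  LinearMap.mkContinuous_norm_le _ zero_le_one _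

theorem signFunctional_single (A : Finset ι) (i : ι) :
    signFunctional A (lp.single 1 i (1 : ℝ)) = sgn A i := by
  change ∑' j, sgn A j * (lp.single 1 i (1 : ℝ) : lp (fun _ : ι => ℝ) 1) j = sgn A i
  rw [tsum_eq_single i fun j hj => by rw [lp.single_apply_ne _ _ _ hj, mul_zero],
    lp.single_apply_self, mul_one]

/-- A space containing `ℓ₁` has an equivalent norm that is `ℓ₁`-additive between any vector and all
but countably many unit vectors of the copy of `ℓ₁`. -/
theorem exists_equivalentNorm_additive {X : Type*} [NormedAddCommGroup X] [NormedSpace ℝ X]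
    (Y : Submodule ℝ X) (Φ : lp (fun _ : ι => ℝ) 1 ≃L[ℝ] Y) :
    ∃ p : Seminorm ℝ X, IsEquivalentNorm p ∧ ∃ e : ι → X, (∀ i, p (e i) ≤ 1) ∧
      ∀ x, ∃ S : Set ι, S.Countable ∧ ∀ i ∉ S, ∀ t : ℝ, p x + |t| ≤ p (x + t • e i) := by
  set L : lp (fun _ : ι => ℝ) 1 →L[ℝ] X := Y.subtypeL.comp (Φ : lp (fun _ : ι => ℝ) 1 →L[ℝ] Y)
    with hL
  set M : ℝ := ‖(Φ.symm : Y →L[ℝ] lp (fun _ : ι => ℝ) 1)‖ with hM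
  have hM0 : 0 ≤ M := by positivity
  have hext : ∀ A : Finset ι, ∃ g : StrongDual ℝ X,
      (∀ u, g (L u) = signFunctional A u) ∧ ‖g‖ ≤ M := by
    intro A
    obtain ⟨g, hg, hn⟩ := exists_extension_norm_eq Y
      ((signFunctional A).comp (Φ.symm : Y →L[ℝ] lp (fun _ : ι => ℝ) 1))
    refine ⟨g, fun u => ?_, ?_⟩
    · have := hg (Φ u)
      simpa [hL] using this
    · rw [hn]
      refine (ContinuousLinearMap.opNorm_comp_le _ _).trans ?_
      exact mul_le_of_le_one_left hM0 (norm_signFunctional_le A)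
  choose g hgL hgM using hext
  set e : ι → X := fun i => L (lp.single 1 i (1 : ℝ)) with he
  obtain ⟨q, hqM, hqe, hqsum, hqadd⟩ := exists_seminorm_of_signs
    (fun A => (g A : X →ₗ[ℝ] ℝ)) e M
    (fun A x => ((g A).le_opNorm x).trans (mul_le_mul_of_nonneg_right (hgM A) (norm_nonneg x)))
    (fun A i => (hgL A _).trans (signFunctional_single A i))
  have hqL : ∀ u, ‖u‖ ≤ q (L u) := by
    intro u
    have h1 : Tendsto (fun F : Finset ι => ∑ i ∈ F, |u i|) atTop (𝓝 ‖u‖) := hasSum_abs_lp_one u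
    have h2 : HasSum (fun i => L (lp.single 1 i (u i))) (L u) :=
      (lp.hasSum_single ENNReal.one_ne_top u).mapL L
    have h3 : Tendsto (fun F : Finset ι => q (∑ i ∈ F, L (lp.single 1 i (u i)))) atTop
        (𝓝 (q (L u))) := ((continuous_of_le_mul_norm hqM).tendsto _).comp h2
    refine le_of_tendsto_of_tendsto' h1 h3 fun F => (hqsum F fun i => u i).trans (le_of_eq ?_)
    congr 1
    refine Finset.sum_congr rfl fun i _ => ?_
    rw [he, ← map_smul, ← lp.single_smul, smul_eq_mul, mul_one]
  -- `q` is bounded below only on `Y`; the quotient seminorm controls the remaining directions and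
  -- does not see the `e i`.
  set d : Seminorm ℝ X := (normSeminorm ℝ (X ⧸ Y)).comp Y.mkQ with hd
  have hdx : ∀ x, d x = ‖Y.mkQ x‖ := fun x => rfl
  have hdnorm : ∀ x, d x ≤ ‖x‖ := fun x => Submodule.Quotient.norm_mk_le Y x
  have hdY : ∀ y ∈ Y, d y = 0 := by
    intro y hy
    rw [hdx, Submodule.mkQ_apply, (Submodule.Quotient.mk_eq_zero Y).2 hy, norm_zero]
  have heY : ∀ i, e i ∈ Y := fun i => (Φ _).2
  have hdadd : ∀ x i (t : ℝ), d (x + t • e i) = d x := by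
    intro x i t
    rw [hdx, map_add, Submodule.mkQ_apply Y (t • e i),
      (Submodule.Quotient.mk_eq_zero Y).2 (Y.smul_mem t (heY i)), add_zero, ← hdx]
  refine ⟨q + d, ?_, e, fun i => ?_, fun x => ?_⟩
  -- Splitting `x` into a part in `Y` and a near-minimal representative `v` of its class gives ‖x‖ ≤
  -- ‖L‖ q x + (‖L‖ M + 1)(d x + ε); `K` dominates both coefficients.
  · set K : ℝ := ‖L‖ + ‖L‖ * M + 1 with hK
    have hL0 : 0 ≤ ‖L‖ := norm_nonneg L
    have hLM : 0 ≤ ‖L‖ * M := mul_nonneg hL0 hM0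
    have hK0 : 0 < K := by positivity
    refine ⟨K⁻¹, M + 1, inv_pos.2 hK0, by positivity, fun x => ⟨?_, ?_⟩⟩
    · refine le_of_forall_pos_le_add fun ε hε => ?_
      rw [inv_mul_le_iff₀ hK0, add_apply]
      obtain ⟨v, hv, hvn⟩ := Submodule.Quotient.norm_mk_lt (S := Y) (Y.mkQ x) hε
      have hxv : x - v ∈ Y := (Submodule.Quotient.eq Y).1 hv.symm
      obtain ⟨u, hu⟩ : ∃ u, L u = x - v := ⟨Φ.symm ⟨x - v, hxv⟩, by simp [hL]⟩
      have h1 : ‖x - v‖ ≤ ‖L‖ * q (x - v) := by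
        rw [← hu]
        exact (L.le_opNorm u).trans (mul_le_mul_of_nonneg_left (hqL u) hL0)
      have h2 : q (x - v) ≤ q x + M * ‖v‖ :=
        (map_sub_le_add q x v).trans (add_le_add_right (hqM v) _)
      have h3 : ‖x‖ ≤ ‖x - v‖ + ‖v‖ := by simpa using norm_add_le (x - v) v
      rw [← hdx] at hvn
      have hq0 : 0 ≤ q x := apply_nonneg q x
      have hd0 : 0 ≤ d x := apply_nonneg d x
      calc ‖x‖ ≤ ‖L‖ * (q x + M * ‖v‖) + ‖v‖ :=
            h3.trans (add_le_add_left (h1.trans (mul_le_mul_of_nonneg_left h2 hL0)) _)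
        _ = ‖L‖ * q x + (‖L‖ * M + 1) * ‖v‖ := by ring
        _ ≤ ‖L‖ * q x + (‖L‖ * M + 1) * (d x + ε) := by gcongr
        _ ≤ K * (q x + d x + ε) := by
            rw [hK]
            nlinarith [mul_nonneg hL0 hd0, mul_nonneg hL0 hε.le, mul_nonneg hLM hq0]
    · rw [add_apply, add_mul, one_mul]
      exact add_le_add (hqM x) (hdnorm x)
  · rw [add_apply, hdY _ (heY i), add_zero]
    exact hqe i
  · obtain ⟨S, hS, h⟩ := hqadd x
    refine ⟨S, hS, fun i hi t => ?_⟩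
    rw [add_apply, add_apply, hdadd]
    linarith [h i hi t]

end Renorming

/-! ### Unit balls, tilings and discreteness -/

section Balls

variable {X : Type*} [NormedAddCommGroup X] [NormedSpace ℝ X] {p : Seminorm ℝ X}

theorem IsEquivalentNorm.continuous (hp : IsEquivalentNorm p) : Continuous p := by
  obtain ⟨c, C, -, -, h⟩ := hp
  exact continuous_of_le_mul_norm fun x => (h x).2

theorem ball_subset_interior_closedBall (hp : Continuous p) (x : X) :
    p.ball x 1 ⊆ interior (p.closedBall x 1) := by
  refine interior_maximal (p.ball_subset_closedBall x 1) ?_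
  have : p.ball x 1 = (fun y => p (y - x)) ⁻¹' Set.Iio 1 := by
    ext y; simp [Seminorm.mem_ball]
  rw [this]
  exact isOpen_Iio.preimage (hp.comp (continuous_id.sub continuous_const))

/-- An interior point can be pushed slightly away from the centre without leaving the closed ball.
-/
theorem interior_closedBall_subset_ball (x : X) :
    interior (p.closedBall x 1) ⊆ p.ball x 1 := by
  intro y hy
  have ht : Tendsto (fun t : ℝ => y + t • (y - x)) (𝓝[>] 0) (𝓝 y) := by
    have h : Continuous fun t : ℝ => y + t • (y - x) := by fun_prop
    have := (h.tendsto 0).mono_left (nhdsWithin_le_nhds (s := Set.Ioi (0 : ℝ)))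
    simpa using this
  obtain ⟨t, ht1, ht0⟩ := ((ht.eventually (mem_interior_iff_mem_nhds.1 hy)).and
    self_mem_nhdsWithin).exists
  have ht0 : 0 < t := ht0
  have h1 : p ((1 + t) • (y - x)) ≤ 1 := by
    have : p (y + t • (y - x) - x) ≤ 1 := p.mem_closedBall.1 ht1
    convert this using 2
    module
  rw [map_smul_eq_mul, Real.norm_of_nonneg (by linarith)] at h1
  rw [Seminorm.mem_ball]
  nlinarith [apply_nonneg p (y - x)]

theorem isBody_closedBall (hp : Continuous p) (x : X) : IsBody (p.closedBall x 1) := by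
  refine ⟨⟨x, ball_subset_interior_closedBall hp x (p.mem_ball_self one_pos)⟩,
    Set.Subset.antisymm ?_ fun y hy => ?_⟩
  · have hc : IsClosed (p.closedBall x 1) := by
      have : p.closedBall x 1 = (fun y => p (y - x)) ⁻¹' Set.Iic 1 := by
        ext y; simp [Seminorm.mem_closedBall]
      rw [this]
      exact isClosed_Iic.preimage (hp.comp (continuous_id.sub continuous_const))
    exact closure_minimal interior_subset hc
  · have ht : Tendsto (fun t : ℝ => x + t • (y - x)) (𝓝[<] 1) (𝓝 y) := by
      have h : Continuous fun t : ℝ => x + t • (y - x) := by fun_prop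
      have := (h.tendsto 1).mono_left (nhdsWithin_le_nhds (s := Set.Iio (1 : ℝ)))
      simpa using this
    refine mem_closure_of_tendsto ht ?_
    have h0 : ∀ᶠ t : ℝ in 𝓝[<] 1, 0 < t :=
      nhdsWithin_le_nhds (eventually_gt_nhds zero_lt_one)
    filter_upwards [h0, self_mem_nhdsWithin] with t ht0 ht1
    refine ball_subset_interior_closedBall hp x (p.mem_ball.2 ?_)
    rw [add_sub_cancel_left, map_smul_eq_mul, Real.norm_of_nonneg ht0.le]
    have hy1 : p (y - x) ≤ 1 := p.mem_closedBall.1 hy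
    exact (mul_le_of_le_one_right ht0.le hy1).trans_lt ht1

theorem disjoint_interior_closedBall {x y : X} (h : 2 ≤ p (x - y)) :
    Disjoint (interior (p.closedBall x 1)) (interior (p.closedBall y 1)) := by
  rw [Set.disjoint_left]
  intro z hx hy
  have hx' := p.mem_ball.1 (interior_closedBall_subset_ball x hx)
  have hy' := p.mem_ball.1 (interior_closedBall_subset_ball y hy)
  have := map_sub_le_add p (z - y) (z - x)
  rw [show z - y - (z - x) = x - y by abel] at this
  linarith

theorem disjoint_closedBall {x y : X} (h : 2 < p (x - y)) :
    Disjoint (p.closedBall x 1) (p.closedBall y 1) := by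
  rw [Set.disjoint_left]
  intro z hx hy
  have hx' := p.mem_closedBall.1 hx
  have hy' := p.mem_closedBall.1 hy
  have := map_sub_le_add p (z - y) (z - x)
  rw [show z - y - (z - x) = x - y by abel] at this
  linarith

/-- Balls of radius one about a set of centres that is `2`-separated and at distance at most one
from every point form a tiling. -/
theorem isTiling_image_closedBall (hp : Continuous p) {D : Set X}
    (hsep : D.Pairwise fun x y => 2 ≤ p (x - y)) (hcov : ∀ x, ∃ d ∈ D, p (x - d) ≤ 1) :
    IsTiling ((fun d => p.closedBall d 1) '' D) := by
  refine ⟨?_, ?_, ?_⟩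
  · rintro _ ⟨d, -, rfl⟩
    exact isBody_closedBall hp d
  · refine Set.eq_univ_of_forall fun x => ?_
    obtain ⟨d, hd, hxd⟩ := hcov x
    exact ⟨_, ⟨d, hd, rfl⟩, p.mem_closedBall.2 hxd⟩
  · rintro _ ⟨d, hd, rfl⟩ _ ⟨d', hd', rfl⟩ hne
    exact disjoint_interior_closedBall (hsep hd hd' fun h => hne (by rw [h]))

theorem discreteTopology_of_separated (hp : Continuous p) (D : AddSubgroup X)
    (hD : ∀ d ∈ D, d ≠ 0 → 2 ≤ p d) : DiscreteTopology D := by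
  refine discreteTopology_of_isOpen_singleton_zero ?_
  have : ({0} : Set D) = (fun d : D => p (d : X)) ⁻¹' Set.Iio 2 := by
    ext d
    simp only [Set.mem_singleton_iff, Set.mem_preimage, Set.mem_Iio]
    refine ⟨fun h => by simp [h], fun h => ?_⟩
    by_contra hne
    exact absurd (hD d d.2 fun h0 => hne (Subtype.ext h0)) (not_le.2 h)
  rw [this]
  exact isOpen_Iio.preimage (hp.comp continuous_subtype_val)

end Balls

/-! ### Transfinite choice of centres -/

section Recursion

/-- Every type carries a well-order all of whose initial segments have smaller cardinality. -/
theorem exists_wellOrder_initialSegments_lt (X : Type u) :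
    ∃ r : X → X → Prop, IsWellOrder X r ∧ ∀ x, #{y | r y x} < #X := by
  obtain ⟨r, wo, h⟩ := Cardinal.exists_ord_eq X
  refine ⟨r, wo, fun x => ?_⟩
  have := Cardinal.card_typein_lt (r := r) x h
  rwa [Ordinal.card_typein] at this

theorem exists_of_forall_initialSegment {X Z : Type*} {r : X → X → Prop} (hr : WellFounded r)
    (Q : ∀ x : X, ({y | r y x} → Z) → Z → Prop) (hQ : ∀ x h, ∃ v, Q x h v) :
    ∃ c : X → Z, ∀ x, Q x (fun y => c y) (c x) := by
  choose F hF using hQ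
  refine ⟨hr.fix fun x h => F x fun y => h y y.2, fun x => ?_⟩
  rw [hr.fix_eq]
  exact hF x _

theorem mk_addSubgroup_closure_le {G : Type u} [AddCommGroup G] (s : Set G) :
    #(AddSubgroup.closure s) ≤ max #s ℵ₀ := by
  rcases s.eq_empty_or_nonempty with rfl | hs
  · rw [AddSubgroup.closure_empty]
    exact (Cardinal.lt_aleph0_of_finite _).le.trans (le_max_right _ _)
  · have : Nonempty s := hs.to_subtype
    rw [← Cardinal.mk_freeAbelianGroup]
    have hle : AddSubgroup.closure s ≤ (FreeAbelianGroup.lift ((↑) : s → G)).range := by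
      rw [AddSubgroup.closure_le]
      exact fun x hx => ⟨FreeAbelianGroup.of ⟨x, hx⟩, FreeAbelianGroup.lift_apply_of _ _⟩
    exact (Cardinal.mk_le_mk_of_subset (t := Set.range (FreeAbelianGroup.lift ((↑) : s → G)))
      hle).trans Cardinal.mk_range_le

variable {X : Type u} [NormedAddCommGroup X] [NormedSpace ℝ X] {p : Seminorm ℝ X}
  {Γ : Cardinal.{u}}

theorem exists_disjoint_centres (hX : #X ≤ Γ)
    (hadd : ∀ S : Set X, #S < Γ →
      ∃ e, p e ≤ 1 ∧ ∀ y ∈ S, ∀ t : ℝ, p y + |t| ≤ p (y + t • e)) :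
    ∃ D : Set X, (D.Pairwise fun x y => 2 < p (x - y)) ∧ ∀ x, ∃ d ∈ D, p (x - d) ≤ 1 := by
  obtain ⟨r, wo, hr⟩ := exists_wellOrder_initialSegments_lt X
  obtain ⟨c, hc⟩ := exists_of_forall_initialSegment (Z := X) (wo.wf)
    (fun x h v => p (x - v) ≤ 1 ∧
      -- A point already covered reuses an old centre, so the recursion never has to stop.
      ((∃ y, v = h y) ∨ ∀ y, 2 < p (v - h y))) fun x h => by
    by_cases hcov : ∃ y, p (x - h y) ≤ 1
    · obtain ⟨y, hy⟩ := hcov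
      exact ⟨h y, hy, Or.inl ⟨y, rfl⟩⟩
    · push Not at hcov
      obtain ⟨e, he, hS⟩ := hadd (Set.range fun y => x - h y)
        (Cardinal.mk_range_le.trans_lt ((hr x).trans_le hX))
      refine ⟨x + e, by simpa using he, Or.inr fun y => ?_⟩
      have := hS _ ⟨y, rfl⟩ 1
      rw [abs_one, one_smul, show x - h y + e = x + e - h y by abel] at this
      linarith [hcov y]
  -- Since centres may repeat, separation is proved by induction: a copied centre `c z` inherits the
  -- comparison between `z` and `y`.
  have hlt : ∀ x y, r y x → c x = c y ∨ 2 < p (c x - c y) := by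
    intro x
    induction x using wo.wf.induction with
    | _ x ih =>
      intro y hy
      rcases (hc x).2 with ⟨⟨z, hz⟩, hxz⟩ | hall
      · dsimp only at hxz
        rw [hxz]
        rcases trichotomous_of r z y with h | h | h
        · rcases ih y hy z h with h' | h'
          · exact Or.inl h'.symm
          · exact Or.inr (by rwa [map_sub_rev])
        · exact Or.inl (by rw [h])
        · exact ih z hz y h
      · exact Or.inr (hall ⟨y, hy⟩)
  refine ⟨Set.range c, ?_, fun x => ⟨c x, ⟨x, rfl⟩, (hc x).1⟩⟩
  rintro _ ⟨x, rfl⟩ _ ⟨y, rfl⟩ hne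
  rcases trichotomous_of r x y with h | h | h
  · rw [map_sub_rev]
    exact (hlt y x h).resolve_left (Ne.symm hne)
  · exact absurd (by rw [h]) hne
  · exact (hlt x y h).resolve_left hne

/-- Adjoining `x + e` to a `2`-separated subgroup keeps it `2`-separated if `x` is at distance more
than one from the subgroup and `e` is `ℓ₁`-additive. -/
theorem two_le_of_mem_closure_insert {H : AddSubgroup X} (hH : ∀ d ∈ H, d ≠ 0 → 2 ≤ p d)
    {x e : X} (hx : ∀ d ∈ H, 1 < p (x - d))
    (he : ∀ d ∈ H, ∀ n : ℤ, p (d + n • x) + |(n : ℝ)| ≤ p (d + n • x + (n : ℝ) • e))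
    {d : X} (hd : d ∈ H) (n : ℤ) (hne : d + n • (x + e) ≠ 0) : 2 ≤ p (d + n • (x + e)) := by
  have h := he d hd n
  have heq : d + n • x + (n : ℝ) • e = d + n • (x + e) := by
    rw [Int.cast_smul_eq_zsmul, smul_add, add_assoc]
  rw [heq] at h
  have h0 : 0 ≤ p (d + n • x) := apply_nonneg p _
  by_cases hn0 : n = 0
  · subst hn0
    rw [zero_smul, add_zero] at hne ⊢
    exact hH d hd hne
  by_cases hn2 : 2 ≤ |n|
  · have : (2 : ℝ) ≤ |(n : ℝ)| := by exact_mod_cast hn2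
    linarith
  have hn1 : |n| = 1 := by
    have := abs_pos.2 hn0
    omega
  have hn1' : |(n : ℝ)| = 1 := by exact_mod_cast hn1
  have h1 : 1 < p (d + n • x) := by
    rcases (abs_eq (zero_le_one' ℤ)).1 hn1 with rfl | rfl
    · have := hx (-d) (H.neg_mem hd)
      rwa [sub_neg_eq_add, add_comm, ← one_zsmul x] at this
    · have := hx d hd
      rwa [map_sub_rev, sub_eq_add_neg, ← neg_one_zsmul x] at this
  linarith

/-- A nonzero element involves finitely many generators, and `z` can be taken to be the largest of
their indices. This reduces separation of a union of stages to a single stage. -/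
theorem mem_closure_initialSegment {X Z : Type*} [AddCommGroup Z]
    {r : X → X → Prop} [IsWellOrder X r] {c : X → Z} {s : Set X} {d : Z}
    (hd : d ∈ AddSubgroup.closure (c '' s)) (hd0 : d ≠ 0) :
    ∃ z ∈ s, d ∈ AddSubgroup.closure (insert (c z) (c '' {y | r y z})) := by
  have hmono : ∀ z z', r z z' → AddSubgroup.closure (insert (c z) (c '' {y | r y z})) ≤
      AddSubgroup.closure (insert (c z') (c '' {y | r y z'})) := by
    intro z z' h
    refine AddSubgroup.closure_mono ?_
    rintro _ (rfl | ⟨y, hy, rfl⟩)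
    · exact Or.inr ⟨z, h, rfl⟩
    · exact Or.inr ⟨y, _root_.trans (r := r) hy h, rfl⟩
  suffices d = 0 ∨ ∃ z ∈ s, d ∈ AddSubgroup.closure (insert (c z) (c '' {y | r y z})) from
    this.resolve_left hd0
  clear hd0
  induction hd using AddSubgroup.closure_induction with
  | mem x hx =>
    obtain ⟨z, hz, rfl⟩ := hx
    exact Or.inr ⟨z, hz, AddSubgroup.subset_closure (Set.mem_insert _ _)⟩
  | zero => exact Or.inl rfl
  | add x y _ _ hx hy =>
    rcases hx with rfl | ⟨z, hz, hxz⟩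
    · rwa [zero_add]
    rcases hy with rfl | ⟨w, hw, hyw⟩
    · rw [add_zero]
      exact Or.inr ⟨z, hz, hxz⟩
    rcases trichotomous_of r z w with h | rfl | h
    · exact Or.inr ⟨w, hw, add_mem (hmono _ _ h hxz) hyw⟩
    · exact Or.inr ⟨z, hz, add_mem hxz hyw⟩
    · exact Or.inr ⟨z, hz, add_mem hxz (hmono _ _ h hyw)⟩
  | neg x _ hx =>
    rcases hx with rfl | ⟨z, hz, hxz⟩
    · exact Or.inl neg_zero
    · exact Or.inr ⟨z, hz, neg_mem hxz⟩

theorem exists_lattice_centres (hΓ : ℵ₀ < Γ) (hX : #X ≤ Γ)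
    (hadd : ∀ S : Set X, #S < Γ →
      ∃ e, p e ≤ 1 ∧ ∀ y ∈ S, ∀ t : ℝ, p y + |t| ≤ p (y + t • e)) :
    ∃ D : AddSubgroup X, (∀ d ∈ D, d ≠ 0 → 2 ≤ p d) ∧ ∀ x, ∃ d ∈ D, p (x - d) ≤ 1 := by
  obtain ⟨r, wo, hr⟩ := exists_wellOrder_initialSegments_lt X
  obtain ⟨c, hc⟩ := exists_of_forall_initialSegment (Z := X) (wo.wf)
    (fun x h v => (∃ d ∈ AddSubgroup.closure (insert v (Set.range h)), p (x - d) ≤ 1) ∧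
      ((∀ d ∈ AddSubgroup.closure (Set.range h), d ≠ 0 → 2 ≤ p d) →
        ∀ d ∈ AddSubgroup.closure (insert v (Set.range h)), d ≠ 0 → 2 ≤ p d)) fun x h => by
    by_cases hcov : ∃ d ∈ AddSubgroup.closure (Set.range h), p (x - d) ≤ 1
    · obtain ⟨d, hd, hxd⟩ := hcov
      -- If `x` is covered, adjoining the lattice point `d` does not enlarge the subgroup.
      refine ⟨d, ⟨d, AddSubgroup.subset_closure (Set.mem_insert _ _), hxd⟩, fun H a ha => H a ?_⟩
      refine (AddSubgroup.closure_le _).2 ?_ ha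
      rintro _ (rfl | hy)
      · exact hd
      · exact AddSubgroup.subset_closure hy
    · push Not at hcov
      set H := AddSubgroup.closure (Set.range h) with hH
      -- `e` must be additive with every `d + n • x`, hence with the whole group generated by `x`
      -- and the earlier centres, which still has fewer than Γ elements.
      obtain ⟨e, he, hS⟩ := hadd (AddSubgroup.closure (insert x (Set.range h)))
        ((mk_addSubgroup_closure_le _).trans_lt (max_lt ((Cardinal.mk_insert_le).trans_lt
          (Cardinal.add_lt_of_lt hΓ.le (Cardinal.mk_range_le.trans_lt ((hr x).trans_le hX))
            (Cardinal.one_lt_aleph0.trans hΓ))) hΓ))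
      refine ⟨x + e, ⟨x + e, AddSubgroup.subset_closure (Set.mem_insert _ _), by simpa using he⟩,
        fun hsep a ha hne => ?_⟩
      rw [Set.insert_eq, AddSubgroup.closure_union, AddSubgroup.mem_sup] at ha
      obtain ⟨b, hb, d, hd, rfl⟩ := ha
      obtain ⟨n, rfl⟩ := AddSubgroup.mem_closure_singleton.1 hb
      rw [add_comm] at hne ⊢
      refine two_le_of_mem_closure_insert hsep hcov (fun d hd n => hS _ ?_ _) hd n hne
      exact add_mem (AddSubgroup.closure_mono (Set.subset_insert _ _) hd)
        (zsmul_mem (AddSubgroup.subset_closure (Set.mem_insert _ _)) n)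
  have hrange : ∀ x, Set.range (fun y : {y | r y x} => c y) = c '' {y | r y x} := fun x => by
    rw [Set.image_eq_range]
  simp only [hrange] at hc
  have hlt : ∀ x, ∀ d ∈ AddSubgroup.closure (insert (c x) (c '' {y | r y x})),
      d ≠ 0 → 2 ≤ p d := by
    intro x
    induction x using wo.wf.induction with
    | _ x ih =>
      refine (hc x).2 fun d hd hd0 => ?_
      obtain ⟨z, hz, hdz⟩ := mem_closure_initialSegment (r := r) hd hd0
      exact ih z hz d hdz hd0
  refine ⟨AddSubgroup.closure (c '' Set.univ), fun d hd hd0 => ?_, fun x => ?_⟩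
  · obtain ⟨z, -, hdz⟩ := mem_closure_initialSegment (r := r) hd hd0
    exact hlt z d hdz hd0
  · obtain ⟨d, hd, hxd⟩ := (hc x).1
    refine ⟨d, AddSubgroup.closure_mono ?_ hd, hxd⟩
    rintro _ (rfl | ⟨y, -, rfl⟩) <;> exact ⟨_, trivial, rfl⟩

end Recursion

/-! ### Cardinal estimates -/

section Cardinality

theorem exists_dense_mk_eq_density (X : Type u) [TopologicalSpace X] :
    ∃ s : Set X, Dense s ∧ #s = density X :=
  csInf_mem (s := {κ : Cardinal.{u} | ∃ s : Set X, Dense s ∧ #s = κ})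
    ⟨_, Set.univ, dense_univ, rfl⟩

/-- Each point is determined by a sequence in a dense set converging to it. -/
theorem mk_le_density_power_aleph0 (X : Type u) [TopologicalSpace X] [T2Space X]
    [FrechetUrysohnSpace X] : #X ≤ density X ^ ℵ₀ := by
  obtain ⟨s, hs, hcard⟩ := exists_dense_mk_eq_density X
  have hseq : ∀ x : X, ∃ a : ℕ → s, Tendsto (fun n => (a n : X)) atTop (𝓝 x) := fun x => by
    obtain ⟨a, ha, hax⟩ := mem_closure_iff_seq_limit.1 (hs x)
    exact ⟨fun n => ⟨a n, ha n⟩, hax⟩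
  choose a ha using hseq
  have hinj : Function.Injective a := fun x y hxy =>
    tendsto_nhds_unique (ha x) (by rw [hxy]; exact ha y)
  rw [← hcard]
  refine (Cardinal.mk_le_of_injective hinj).trans (le_of_eq ?_)
  simp

theorem aleph0_lt_of_power_aleph0_eq {Γ : Cardinal.{u}} (hΓ : Γ ^ ℵ₀ = Γ) (h : 2 ≤ Γ) : ℵ₀ < Γ :=
  calc ℵ₀ < 2 ^ ℵ₀ := Cardinal.cantor _
    _ ≤ Γ ^ ℵ₀ := Cardinal.power_le_power_right h
    _ = Γ := hΓ

theorem density_ne_zero {X : Type u} [TopologicalSpace X] [Nonempty X] :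
    density X ≠ 0 := by
  obtain ⟨s, hs, hcard⟩ := exists_dense_mk_eq_density X
  rw [← hcard, Cardinal.mk_ne_zero_iff]
  exact hs.nonempty.to_subtype

theorem mk_biUnion_countable_lt {X ι : Type u} {Γ : Cardinal.{u}} (hΓ : ℵ₀ < Γ) {S : Set X}
    (hS : #S < Γ) {f : X → Set ι} (hf : ∀ x, (f x).Countable) :
    #(⋃ x ∈ S, f x : Set ι) < Γ := by
  refine (Cardinal.mk_biUnion_le f S).trans_lt ?_
  refine Cardinal.mul_lt_of_lt hΓ.le hS ((ciSup_le' fun x => ?_).trans_lt hΓ)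
  exact (hf x).le_aleph0

end Cardinality

end BallTiling

/-! ### Assembly of the theorem -/

theorem theorem3p11 (Γ : Cardinal.{u}) (hΓ : Γ ^ ℵ₀ = Γ)
    (X : Type u) [NormedAddCommGroup X] [NormedSpace ℝ X] [CompleteSpace X]
    (hdens : BallTiling.density X = Γ) (hX : BallTiling.ContainsEllOne Γ X) :
    ∃ p : Seminorm ℝ X, BallTiling.IsEquivalentNorm p ∧
      (∃ 𝒯 : Set (Set X), BallTiling.IsDisjointTilingByUnitBalls p 𝒯) ∧
      (∃ 𝒯 : Set (Set X), BallTiling.IsLatticeTilingByBalls p 𝒯) := by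
  classical
  open BallTiling in
  obtain ⟨Y, ⟨Φ⟩⟩ := hX
  have hXΓ : #X ≤ Γ := by
    rw [← hΓ, ← hdens]
    exact mk_le_density_power_aleph0 X
  -- Γ = 0 and Γ = 1 must be excluded: a dense set is nonempty, so ℓ₁(Γ) and hence `X` has a nonzero
  -- vector, which gives Γ ≥ 2.
  have hΓ0 : ℵ₀ < Γ := by
    have : Nonempty Γ.out := by
      rw [← Cardinal.mk_ne_zero_iff, Cardinal.mk_out, ← hdens]
      exact density_ne_zero
    obtain ⟨i⟩ := this
    have hne : (Φ (lp.single 1 i (1 : ℝ)) : X) ≠ 0 := by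
      intro h
      have h0 : lp.single 1 i (1 : ℝ) = (0 : EllOne Γ) :=
        Φ.map_eq_zero_iff.1 (Subtype.ext h)
      have := lp.single_apply_self (E := fun _ : Γ.out => ℝ) 1 i (1 : ℝ)
      rw [h0] at this
      exact zero_ne_one this
    have : Nontrivial X := ⟨⟨_, 0, hne⟩⟩
    refine aleph0_lt_of_power_aleph0_eq hΓ ((Cardinal.two_le_iff.2 ?_).trans hXΓ)
    exact ⟨_, 0, hne⟩
  obtain ⟨p, hp, e, he, hadd⟩ := exists_equivalentNorm_additive Y Φ
  choose S hScount hS using hadd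
  have hstar : ∀ A : Set X, #A < Γ →
      ∃ e, p e ≤ 1 ∧ ∀ y ∈ A, ∀ t : ℝ, p y + |t| ≤ p (y + t • e) := by
    intro A hA
    have hlt := mk_biUnion_countable_lt hΓ0 hA hScount
    obtain ⟨i, hi⟩ : ∃ i, i ∉ ⋃ x ∈ A, S x := by
      by_contra! hall
      rw [Set.eq_univ_of_forall hall, Cardinal.mk_univ, Cardinal.mk_out] at hlt
      exact lt_irrefl _ hlt
    exact ⟨e i, he i, fun y hy t => hS y i (fun h => hi (Set.mem_biUnion hy h)) t⟩
  have hpc := hp.continuous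
  refine ⟨p, hp, ?_, ?_⟩
  · obtain ⟨D, hsep, hcov⟩ := exists_disjoint_centres hXΓ hstar
    refine ⟨(fun d => p.closedBall d 1) '' D,
      isTiling_image_closedBall hpc (fun x hx y hy h => (hsep hx hy h).le) hcov, ?_, ?_⟩
    · rintro _ ⟨d, -, rfl⟩
      exact ⟨d, rfl⟩
    · rintro _ ⟨d, hd, rfl⟩ _ ⟨d', hd', rfl⟩ hne
      exact disjoint_closedBall (hsep hd hd' fun h => hne (by rw [h]))
  · obtain ⟨D, hsep, hcov⟩ := exists_lattice_centres hΓ0 hXΓ hstar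
    refine ⟨(fun d => p.closedBall d 1) '' (D : Set X), isTiling_image_closedBall hpc
      (fun x hx y hy h => hsep _ (D.sub_mem hx hy) (sub_ne_zero.2 h)) hcov, D,
      discreteTopology_of_separated hpc D hsep, ?_⟩
    have htrans : ∀ d : X, (fun x => d + x) '' p.closedBall 0 1 = p.closedBall d 1 := by
      intro d
      ext y
      rw [Set.image_add_left, Set.mem_preimage, Seminorm.mem_closedBall, Seminorm.mem_closedBall,
        sub_zero, neg_add_eq_sub]
    ext T
    constructor
    · rintro ⟨d, hd, rfl⟩
      exact ⟨d, hd, (htrans d).symm⟩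
    · rintro ⟨d, hd, rfl⟩
      exact ⟨d, hd, (htrans d).symm⟩
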